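/- Let $R=\mathbb{F}_2\langle a,x : a=a^2x\rangle$ be the quotient of the free associative unital $\mathbb{F}_2$-algebra on two generators $a,x$ by the two-sided ideal generated by $a-a^2x$. Write $\mathrm{U}(R)$ for the set of units of $R$, $\mathrm{N}(R)$ for the set of nilpotent elements of $R$, and $\mathrm{J}(R)$ for the Jacobson radical of $R$. An element $r$ of a ring $S$ is called right (respectively left) strongly $\pi$-regular if there are an integer $n\ge 1$ and an element $y\in S$ with $r^n=r^{n+1}y$ (respectively $r^n=yr^{n+1}$); it is called strongly $\pi$-regular if it is both. A ring is right Dischinger if each of its right strongly $\pi$-regular elements is strongly $\pi$-regular. Then: 1. every unit $u$ of $R$ is unipotent, that is, $u-1$ is nilpotent; in other words, $R$ is a UU ring; 2. $R$ is not right Dischinger; 3. $\mathrm{J}(R)=0$; 4. $\mathrm{N}(R)+\mathrm{U}(R)\subseteq \mathrm{U}(R)$. -/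

import Mathlib

open scoped Pointwise

/-- `r` is right strongly π-regular: `r ^ n = r ^ (n + 1) * y` for some `y` and some `n ≥ 1`. -/
def IsRightStronglyPiRegular {S : Type*} [Ring S] (r : S) : Prop :=
  ∃ n : ℕ, 1 ≤ n ∧ ∃ y : S, r ^ n = r ^ (n + 1) * y

/-- `r` is left strongly π-regular: `r ^ n = y * r ^ (n + 1)` for some `y` and some `n ≥ 1`. -/
def IsLeftStronglyPiRegular {S : Type*} [Ring S] (r : S) : Prop :=
  ∃ n : ℕ, 1 ≤ n ∧ ∃ y : S, r ^ n = y * r ^ (n + 1)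

/-- A ring is right Dischinger if each of its right strongly π-regular elements is
strongly π-regular, that is, also left strongly π-regular. -/
def IsRightDischinger (S : Type*) [Ring S] : Prop :=
  ∀ r : S, IsRightStronglyPiRegular r →
    IsRightStronglyPiRegular r ∧ IsLeftStronglyPiRegular r

/-- Equivalent form of the definition, with strongly regular elements (exponent `1`). -/
theorem isRightDischinger_iff (S : Type*) [Ring S] :
    IsRightDischinger S ↔
      ∀ r : S, (∃ y : S, r = r ^ 2 * y) → (∃ y : S, r = r ^ 2 * y) ∧ ∃ y : S, r = y * r ^ 2 := by
  have shift : ∀ (r y : S) (n : ℕ), r ^ n = r ^ (n + 1) * y →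
      ∀ k, r ^ n = r ^ (n + k) * y ^ k := by
    intro r y n h k
    induction k with
    | zero => simp
    | succ k ih =>
      calc r ^ n = r ^ (n + k) * y ^ k := ih
        _ = r ^ k * r ^ n * y ^ k := by rw [← pow_add, Nat.add_comm k n]
        _ = r ^ k * (r ^ (n + 1) * y) * y ^ k := by rw [← h]
        _ = r ^ (n + (k + 1)) * y ^ (k + 1) := by
          rw [← mul_assoc, ← pow_add, mul_assoc, ← pow_succ']
          congr 2
          omega
  constructor
  · rintro h r ⟨y, hy⟩
    refine ⟨⟨y, hy⟩, ?_⟩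
    obtain ⟨-, n, hn, z, hz⟩ := h r ⟨1, le_rfl, y, by simpa using hy⟩
    obtain ⟨m, rfl⟩ : ∃ m, n = m + 1 := ⟨n - 1, by omega⟩
    have h1 := shift r y 1 (by simpa using hy) m
    refine ⟨z, ?_⟩
    calc r = r ^ (1 + m) * y ^ m := by simpa using h1
      _ = z * r ^ (m + 1 + 1) * y ^ m := by rw [Nat.add_comm 1 m, hz]
      _ = z * (r * (r ^ (1 + m) * y ^ m)) := by
        rw [pow_succ' r (m + 1), Nat.add_comm 1 m]; simp only [mul_assoc]
      _ = z * r ^ 2 := by rw [← h1, pow_one, pow_two]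
  · rintro h r ⟨n, hn, y, hy⟩
    refine ⟨⟨n, hn, y, hy⟩, n, hn, ?_⟩
    obtain ⟨-, z, hz⟩ := h (r ^ n) ⟨y ^ n, by
      rw [← pow_mul, Nat.mul_two]; exact shift r y n hy n⟩
    refine ⟨z * r ^ (n - 1), ?_⟩
    rw [mul_assoc, ← pow_add]
    convert hz using 2
    rw [← pow_mul]
    congr 1
    omega

/-- A ring is a UU ring if each unit `u` is unipotent, that is, `u - 1` is nilpotent. -/
def IsUURing (S : Type*) [Ring S] : Prop :=
  ∀ u : S, IsUnit u → IsNilpotent (u - 1)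

/-- The two generators. -/
inductive Gen : Type
  | a : Gen
  | x : Gen

/-- The single defining relation `a = a² x` on the free unital `𝔽₂`-algebra on `a`, `x`. -/
inductive DKNRel : FreeAlgebra (ZMod 2) Gen → FreeAlgebra (ZMod 2) Gen → Prop
  | rel : DKNRel (FreeAlgebra.ι (ZMod 2) Gen.a)
      (FreeAlgebra.ι (ZMod 2) Gen.a ^ 2 * FreeAlgebra.ι (ZMod 2) Gen.x)

/-- The ring `𝔽₂⟨a, x : a = a² x⟩`. -/
abbrev DKNRing : Type := RingQuot DKNRel

/-! Let `W` be the free algebra over 𝔽₂ on z₀, z₁, …. The ring acts on the free left `W`-module with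
basis e₀, e₁, … by x·eₖ = eₖ₊₁, a·e₀ = 0, a·eₖ₊₁ = eₖ − zₖe₀. The letter zⱼ records (1 − ax)xʲ,
since (1 − ax)eⱼ = zⱼe₀. The action is faithful (`rep_injective`), so ring elements become
column-finite matrices over `W`, and the claims become statements about triangularity.

The core is `rep_basisCol_eq_zero`: if g kills a column whose k-th entry is nonzero, then g kills
e₀, …, eₖ. Indeed g·eₖ₊₁ is a shift of g·eₖ up to a left multiple of 1 − z₀, and a leading-word
argument (`eq_zero_of_mul_mem_initSpan`) shows that such columns are left independent from the first
nonzero one on.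

Hence units are upper triangular (`rep_unit_mem_lowCol`), with diagonal 1 because `W` has no other
unit. Far to the right the columns of a matrix are successive shifts, and their constant
coefficients give a polynomial, which for a unit must be a power of X. So u − 1 is strictly upper
triangular with finitely many nonzero rows (`isStrict_sub_one`).

Such strict elements are nilpotent and closed under addition, which gives the UU property and N + U
⊆ U. If j is in the Jacobson radical, every xᵏj is strict, which forces j = 0. Finally aⁿ⁺¹eₙ = 0 ≠
aⁿeₙ, so a is not left strongly π-regular. -/

namespace DKN

/-! ### The algebra of words. -/

/-- The free `𝔽₂`-algebra on letters indexed by `ℕ`, as the algebra of words. -/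
abbrev WordAlg : Type := MonoidAlgebra (ZMod 2) (FreeMonoid ℕ)

/-- The element of the algebra of words given by a single word. -/
noncomputable abbrev word (w : FreeMonoid ℕ) : WordAlg := MonoidAlgebra.single w 1

/-- The `j`-th letter. -/
noncomputable abbrev letter (j : ℕ) : WordAlg := word (FreeMonoid.of j)

theorem word_mul_word (u v : FreeMonoid ℕ) : word u * word v = word (u * v) := by
  simp [MonoidAlgebra.single_mul_single]

theorem word_one : word 1 = 1 := rfl

theorem zmod_two_eq_one {c : ZMod 2} (h : c ≠ 0) : c = 1 := by
  revert c; decide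

theorem smul_eq_zero_or_self {V : Type*} [AddCommGroup V] [Module (ZMod 2) V] (c : ZMod 2)
    (v : V) : c • v = 0 ∨ c • v = v := by
  by_cases h : c = 0
  · simp [h]
  · simp [zmod_two_eq_one h]

theorem wordAlg_induction {P : WordAlg → Prop} (p : WordAlg) (h0 : P 0) (hw : ∀ w, P (word w))
    (hadd : ∀ p q, P p → P q → P (p + q)) : P p := by
  refine MonoidAlgebra.induction_on p hw hadd fun r x hx => ?_
  rcases smul_eq_zero_or_self r x with h | h <;> rw [h] <;> assumption

/-! ### The length-lexicographic order and leading words. -/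

/-- Key of a word for the length-lexicographic order. -/
def key (w : FreeMonoid ℕ) : ℕ ×ₗ List ℕ := toLex (w.toList.length, w.toList)

theorem key_lt_iff {u v : FreeMonoid ℕ} : key u < key v ↔
    u.toList.length < v.toList.length ∨
      u.toList.length = v.toList.length ∧ u.toList < v.toList := by
  simp [key, Prod.Lex.lt_iff]

theorem key_injective : Function.Injective key := by
  intro u v h
  have := congrArg (fun p => (ofLex p).2) h
  exact this

theorem key_le_of_suffix {u v : FreeMonoid ℕ} (h : u.toList <:+ v.toList) : key u ≤ key v := by
  rcases h.length_le.lt_or_eq with h1 | h1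
  · exact (key_lt_iff.2 (Or.inl h1)).le
  · rw [FreeMonoid.toList.injective (h.eq_of_length h1)]

theorem list_append_right_lt {s t : List ℕ} (l : List ℕ) (hl : s.length = t.length) (h : s < t) :
    s ++ l < t ++ l := by
  induction s generalizing t with
  | nil => cases t <;> simp_all
  | cons a s ih =>
    cases t with
    | nil => simp at hl
    | cons b t =>
      simp only [List.cons_append, List.cons_lt_cons_iff] at h ⊢
      rcases h with h | ⟨rfl, h⟩
      · exact Or.inl h
      · exact Or.inr ⟨rfl, ih (by simpa using hl) h⟩

theorem list_append_left_lt {s t : List ℕ} (l : List ℕ) (h : s < t) : l ++ s < l ++ t := by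
  induction l with
  | nil => exact h
  | cons a l ih => simpa [List.cons_lt_cons_iff] using ih

theorem key_mul_lt_right {u v : FreeMonoid ℕ} (w : FreeMonoid ℕ) (h : key u < key v) :
    key (u * w) < key (v * w) := by
  rw [key_lt_iff] at h ⊢
  simp only [FreeMonoid.toList_mul, List.length_append]
  rcases h with h | ⟨h1, h2⟩
  · left; omega
  · right; exact ⟨by omega, list_append_right_lt _ h1 h2⟩

theorem key_mul_lt_left {u v : FreeMonoid ℕ} (w : FreeMonoid ℕ) (h : key u < key v) :
    key (w * u) < key (w * v) := by
  rw [key_lt_iff] at h ⊢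
  simp only [FreeMonoid.toList_mul, List.length_append]
  rcases h with h | ⟨h1, h2⟩
  · left; omega
  · right; exact ⟨by omega, list_append_left_lt _ h2⟩

/-- The equality clause says that the product of two leading words arises in only one way, so its
coefficient cannot cancel. -/
theorem key_mul_le {u u' v v' : FreeMonoid ℕ} (h : key u ≤ key u') (h' : key v ≤ key v') :
    key (u * v) ≤ key (u' * v') ∧ (key (u * v) = key (u' * v') → u = u' ∧ v = v') := by
  rcases h.lt_or_eq with h1 | h1
  · have h2 := key_mul_lt_right v h1
    have h3 : key (u' * v) ≤ key (u' * v') := by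
      rcases h'.lt_or_eq with h3 | h3
      · exact (key_mul_lt_left u' h3).le
      · rw [key_injective h3]
    exact ⟨(h2.trans_le h3).le, fun e => absurd e (h2.trans_le h3).ne⟩
  · obtain rfl := key_injective h1
    rcases h'.lt_or_eq with h3 | h3
    · exact ⟨(key_mul_lt_left u h3).le, fun e => absurd e (key_mul_lt_left u h3).ne⟩
    · obtain rfl := key_injective h3
      exact ⟨le_rfl, fun _ => ⟨rfl, rfl⟩⟩

theorem key_wellFounded : WellFounded (fun u v : FreeMonoid ℕ => key u < key v) := by
  refine Subrelation.wf (r := fun u v : FreeMonoid ℕ =>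
    List.Shortlex (· < ·) u.toList v.toList) ?_ (InvImage.wf (fun w : FreeMonoid ℕ => w.toList)
      (List.Shortlex.wf wellFounded_lt))
  intro u v h
  exact List.shortlex_def.2 (key_lt_iff.1 h)

/-- `w` is the leading word of `p`. -/
def IsLead (p : WordAlg) (w : FreeMonoid ℕ) : Prop :=
  p.coeff w ≠ 0 ∧ ∀ v, p.coeff v ≠ 0 → key v ≤ key w

theorem IsLead.ne_zero {p : WordAlg} {w : FreeMonoid ℕ} (h : IsLead p w) : p ≠ 0 := by
  rintro rfl
  exact h.1 (by simp)

theorem exists_isLead {p : WordAlg} (hp : p ≠ 0) : ∃ w, IsLead p w := by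
  have hne : p.coeff.support.Nonempty := by
    simpa [Finsupp.support_nonempty_iff] using hp
  obtain ⟨w, hw, h⟩ := Finset.exists_max_image _ key hne
  exact ⟨w, by simpa using hw, fun v hv => h v (by simpa using hv)⟩

theorem IsLead.coeff_eq_one {p : WordAlg} {w : FreeMonoid ℕ} (h : IsLead p w) : p.coeff w = 1 :=
  zmod_two_eq_one h.1

theorem isLead_word (w : FreeMonoid ℕ) : IsLead (word w) w := by
  refine ⟨by simp, fun v hv => ?_⟩
  have : v = w := by
    by_contra hne
    exact hv (by simp [Ne.symm hne])
  rw [this]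

theorem exists_of_coeff_mul_ne_zero {p q : WordAlg} {w : FreeMonoid ℕ}
    (h : (p * q).coeff w ≠ 0) : ∃ u v, p.coeff u ≠ 0 ∧ q.coeff v ≠ 0 ∧ u * v = w := by
  classical
  rw [MonoidAlgebra.coeff_mul] at h
  obtain ⟨u, hu, h⟩ := Finset.exists_ne_zero_of_sum_ne_zero h
  obtain ⟨v, hv, h⟩ := Finset.exists_ne_zero_of_sum_ne_zero h
  refine ⟨u, v, by simpa using hu, by simpa using hv, ?_⟩
  by_contra hne
  exact h (by simp [hne])

theorem IsLead.mul {p q : WordAlg} {u v : FreeMonoid ℕ} (hp : IsLead p u) (hq : IsLead q v) :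
    IsLead (p * q) (u * v) := by
  refine ⟨?_, fun w hw => ?_⟩
  · rw [MonoidAlgebra.coeff_mul_mul_of_uniqueMul]
    · exact mul_ne_zero hp.1 hq.1
    · intro u' v' hu' hv' he
      exact (key_mul_le (hp.2 u' (by simpa using hu')) (hq.2 v' (by simpa using hv'))).2
        (by rw [he])
  · obtain ⟨u', v', hu', hv', rfl⟩ := exists_of_coeff_mul_ne_zero hw
    exact (key_mul_le (hp.2 u' hu') (hq.2 v' hv')).1

theorem IsLead.add_of_lt {p q : WordAlg} {u v : FreeMonoid ℕ} (hp : IsLead p u) (hq : IsLead q v)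
    (h : key u < key v) : IsLead (p + q) v := by
  have h0 : p.coeff v = 0 := by
    by_contra hne
    exact absurd (hp.2 v hne) (not_le.2 h)
  refine ⟨by simpa [h0] using hq.1, fun w hw => ?_⟩
  by_cases h1 : p.coeff w = 0
  · exact hq.2 w (by simpa [h1] using hw)
  · exact (hp.2 w h1).trans h.le

/-- Over 𝔽₂ both leading coefficients are 1, so they cancel without rescaling. -/
theorem IsLead.sub_same {p q : WordAlg} {w : FreeMonoid ℕ} (hp : IsLead p w) (hq : IsLead q w)
    (hne : p - q ≠ 0) : ∃ v, IsLead (p - q) v ∧ key v < key w := by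
  obtain ⟨v, hv⟩ := exists_isLead hne
  refine ⟨v, hv, ?_⟩
  have hle : key v ≤ key w := by
    by_cases h1 : p.coeff v = 0
    · refine hq.2 v fun h2 => hv.1 ?_
      simp [h1, h2]
    · exact hp.2 v h1
  refine lt_of_le_of_ne hle fun he => hv.1 ?_
  rw [key_injective he]
  simp [hp.coeff_eq_one, hq.coeff_eq_one]

/-- A finite sum of elements with distinct leading words vanishes only if it is empty. -/
theorem sum_ne_zero_of_distinct_leads {ι : Type*} (s : Finset ι) (hs : s.Nonempty)
    (p : ι → WordAlg) (w : ι → FreeMonoid ℕ) (hp : ∀ i ∈ s, IsLead (p i) (w i))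
    (hw : ∀ i ∈ s, ∀ j ∈ s, w i = w j → i = j) : ∑ i ∈ s, p i ≠ 0 := by
  obtain ⟨i, hi, hmax⟩ := Finset.exists_max_image s (fun i => key (w i)) hs
  intro h0
  have h1 : ∑ j ∈ s, (p j).coeff (w i) = 0 := by
    have := congrArg (fun q : WordAlg => q.coeff (w i)) h0
    simpa [Finsupp.finsetSum_apply] using this
  rw [Finset.sum_eq_single i] at h1
  · exact (hp i hi).1 h1
  · intro j hj hne
    by_contra hc
    have h2 := (hp j hj).2 _ hc
    exact hne (hw j hj i hi (key_injective (le_antisymm (hmax j hj) h2)))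
  · exact fun h => absurd hi h

/-! ### Incrementing the first letter. -/

/-- Increment the first letter of a word. -/
def incWord (w : FreeMonoid ℕ) : FreeMonoid ℕ :=
  match w.toList with
  | [] => 1
  | a :: t => FreeMonoid.ofList ((a + 1) :: t)

theorem incWord_one : incWord 1 = 1 := rfl

theorem incWord_of_mul (a : ℕ) (t : FreeMonoid ℕ) :
    incWord (FreeMonoid.of a * t) = FreeMonoid.of (a + 1) * t := rfl

theorem word_cases (w : FreeMonoid ℕ) : w = 1 ∨ ∃ a t, w = FreeMonoid.of a * t := by
  induction w using FreeMonoid.casesOn with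
  | one => exact Or.inl rfl
  | of_mul a t => exact Or.inr ⟨a, t, rfl⟩

theorem of_mul_ne_one (a : ℕ) (t : FreeMonoid ℕ) : FreeMonoid.of a * t ≠ 1 := by
  intro h
  have := congrArg FreeMonoid.length h
  simp at this

theorem of_mul_inj {a b : ℕ} {s t : FreeMonoid ℕ}
    (h : FreeMonoid.of a * s = FreeMonoid.of b * t) : a = b ∧ s = t := by
  have := congrArg FreeMonoid.toList h
  simpa using this

theorem incWord_injective : Function.Injective incWord := by
  intro u v h
  rcases word_cases u with rfl | ⟨a, s, rfl⟩ <;> rcases word_cases v with rfl | ⟨b, t, rfl⟩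
  · rfl
  · rw [incWord_one, incWord_of_mul] at h
    exact absurd h.symm (of_mul_ne_one _ _)
  · rw [incWord_one, incWord_of_mul] at h
    exact absurd h (of_mul_ne_one _ _)
  · rw [incWord_of_mul, incWord_of_mul] at h
    obtain ⟨h1, rfl⟩ := of_mul_inj h
    obtain rfl : a = b := by omega
    rfl

theorem key_incWord_lt {u v : FreeMonoid ℕ} (h : key u < key v) :
    key (incWord u) < key (incWord v) := by
  rw [key_lt_iff] at h ⊢
  rcases word_cases u with rfl | ⟨a, s, rfl⟩ <;> rcases word_cases v with rfl | ⟨b, t, rfl⟩ <;>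
    simp_all [incWord_one, incWord_of_mul, List.cons_lt_cons_iff]

theorem key_lt_incWord {u : FreeMonoid ℕ} (h : u ≠ 1) : key u < key (incWord u) := by
  rcases word_cases u with rfl | ⟨a, s, rfl⟩
  · exact absurd rfl h
  · rw [key_lt_iff, incWord_of_mul]
    right
    simp [List.cons_lt_cons_iff]

/-- The linear map incrementing the first letter of each word. -/
noncomputable def inc : WordAlg →ₗ[ZMod 2] WordAlg :=
  MonoidAlgebra.mapDomainLinearMap (ZMod 2) (ZMod 2) incWord

theorem inc_word (w : FreeMonoid ℕ) : inc (word w) = word (incWord w) := by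
  simp [inc]

theorem coeff_inc (p : WordAlg) (w : FreeMonoid ℕ) : (inc p).coeff (incWord w) = p.coeff w :=
  Finsupp.mapDomain_apply incWord_injective _ _

theorem exists_of_coeff_inc_ne_zero {p : WordAlg} {w : FreeMonoid ℕ} (h : (inc p).coeff w ≠ 0) :
    ∃ v, incWord v = w := by
  by_contra hne
  push Not at hne
  exact h (Finsupp.mapDomain_of_notMem_range _ _ fun ⟨v, hv⟩ => hne v hv)

theorem IsLead.inc {p : WordAlg} {w : FreeMonoid ℕ} (h : IsLead p w) :
    IsLead (inc p) (incWord w) := by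
  refine ⟨by rw [coeff_inc]; exact h.1, fun v hv => ?_⟩
  obtain ⟨u, rfl⟩ := exists_of_coeff_inc_ne_zero hv
  rw [coeff_inc] at hv
  rcases (h.2 u hv).lt_or_eq with h1 | h1
  · exact (key_incWord_lt h1).le
  · rw [key_injective h1]

/-- A nonempty left factor contains the first letter of the product, so the right factor is
untouched. -/
theorem inc_word_mul {w : FreeMonoid ℕ} (hw : w ≠ 1) (p : WordAlg) :
    inc (word w * p) = inc (word w) * p := by
  induction p using wordAlg_induction with
  | h0 => simp
  | hw v =>
    obtain ⟨a, t, rfl⟩ := (word_cases w).resolve_left hw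
    rw [word_mul_word, inc_word, inc_word, word_mul_word, mul_assoc, incWord_of_mul,
      incWord_of_mul, mul_assoc]
  | hadd p q hp hq => rw [mul_add, map_add, hp, hq, mul_add]

theorem isLead_one_sub_letter : IsLead (1 - letter 0) (FreeMonoid.of 0) := by
  have h := (isLead_word 1).add_of_lt (isLead_word (FreeMonoid.of 0))
    (key_lt_iff.2 (Or.inl (by simp)))
  have h2 : (1 : WordAlg) - letter 0 = word 1 + letter 0 := by
    rw [word_one, sub_eq_add_neg]
    congr 1
    rw [← MonoidAlgebra.single_neg]
    rfl
  rw [h2]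
  exact h

/-! ### Left independence of sequences produced by incrementing. -/

/-- The left ideal spanned by the first `n` terms of a sequence. -/
noncomputable abbrev initSpan (q : ℕ → WordAlg) (n : ℕ) : Submodule WordAlg WordAlg :=
  Submodule.span WordAlg (q '' Set.Iio n)

theorem initSpan_mono (q : ℕ → WordAlg) {m n : ℕ} (h : m ≤ n) : initSpan q m ≤ initSpan q n :=
  Submodule.span_mono (Set.image_mono (Set.Iio_subset_Iio h))

theorem mem_initSpan (q : ℕ → WordAlg) {m n : ℕ} (h : m < n) : q m ∈ initSpan q n :=
  Submodule.subset_span ⟨m, h, rfl⟩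

/-- Terms with suffix-free leading words are left linearly independent. -/
theorem eq_zero_of_suffixFree {q : ℕ → WordAlg} {w : ℕ → FreeMonoid ℕ} {n : ℕ}
    (hlead : ∀ k ≤ n, IsLead (q k) (w k))
    (hfree : ∀ j k, j < k → k ≤ n → key (w j) < key (w k) ∧ ¬ (w j).toList <:+ (w k).toList)
    {e : WordAlg} (he : e * q n ∈ initSpan q n) : e = 0 := by
  classical
  by_contra hne
  rw [initSpan, ← Set.image_id (q '' Set.Iio n), ← Set.image_comp] at he
  obtain ⟨l, hl, hsum⟩ := (Finsupp.mem_span_image_iff_linearCombination WordAlg).1 he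
  simp only [Function.comp_def, id, Finsupp.linearCombination_apply, Finsupp.sum, smul_eq_mul]
    at hsum
  have hlt : ∀ i ∈ l.support, i < n := fun i hi => by
    have := (Finsupp.mem_supported _ _).1 hl hi
    simpa using this
  -- Moving `e * q n` to the other side turns the membership into one vanishing sum with nonzero
  -- coefficients.
  let c : ℕ → WordAlg := fun i => if i = n then -e else l i
  let s := insert n l.support
  have hn : n ∉ l.support := fun h => absurd (hlt n h) (lt_irrefl n)
  have hc : ∀ i ∈ s, c i ≠ 0 ∧ i ≤ n := by
    intro i hi
    rcases Finset.mem_insert.1 hi with rfl | hi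
    · simp [c, hne]
    · have h1 := hlt i hi
      refine ⟨?_, h1.le⟩
      simp only [c, if_neg h1.ne]
      exact Finsupp.mem_support_iff.1 hi
  choose! v hv using fun i (hi : i ∈ s) => exists_isLead (hc i hi).1
  refine sum_ne_zero_of_distinct_leads s ⟨n, Finset.mem_insert_self _ _⟩ (fun i => c i * q i)
    (fun i => v i * w i) (fun i hi => (hv i hi).mul (hlead i (hc i hi).2)) ?_ ?_
  · have key : ∀ i ∈ s, ∀ j ∈ s, i < j → v i * w i ≠ v j * w j := by
      intro i hi j hj hij he
      have h1 : (w i).toList <:+ (v j * w j).toList := by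
        rw [← he]; exact List.suffix_append _ _
      have h2 : (w j).toList <:+ (v j * w j).toList := List.suffix_append _ _
      obtain ⟨h3, h4⟩ := hfree i j hij (hc j hj).2
      -- Two suffixes of one word are comparable; the order of the keys excludes the remaining
      -- direction.
      rcases List.suffix_or_suffix_of_suffix h1 h2 with h5 | h5
      · exact h4 h5
      · exact absurd (key_le_of_suffix h5) (not_le.2 h3)
    intro i hi j hj he
    rcases lt_trichotomy i j with h | h | h
    · exact absurd he (key i hi j hj h)
    · exact h
    · exact absurd he.symm (key j hj i hi h)
  · rw [Finset.sum_insert hn]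
    have h1 : ∑ i ∈ l.support, c i * q i = e * q n := by
      rw [← hsum]
      refine Finset.sum_congr rfl fun i hi => ?_
      simp only [c, if_neg (hlt i hi).ne]
    rw [h1]
    simp [c]

/-- Reduction modulo a left ideal: the leading word can be made to avoid given suffixes. -/
theorem exists_reduced {q : ℕ → WordAlg} {w : ℕ → FreeMonoid ℕ} {n : ℕ}
    (hlead : ∀ k < n, IsLead (q k) (w k)) (s : WordAlg) :
    ∃ t, s - t ∈ initSpan q n ∧
      (t = 0 ∨ ∃ v, IsLead t v ∧ ∀ k < n, ¬ (w k).toList <:+ v.toList) := by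
  have main : ∀ v s, IsLead s v → ∃ t, s - t ∈ initSpan q n ∧
      (t = 0 ∨ ∃ v, IsLead t v ∧ ∀ k < n, ¬ (w k).toList <:+ v.toList) := by
    intro v
    induction v using key_wellFounded.induction with
    | _ v ih =>
      intro s hs
      by_cases hk : ∀ k < n, ¬ (w k).toList <:+ v.toList
      · exact ⟨s, by simp, Or.inr ⟨v, hs, hk⟩⟩
      · push Not at hk
        obtain ⟨k, hk, r, hr⟩ := hk
        have hv : v = FreeMonoid.ofList r * w k := by
          apply FreeMonoid.toList.injective
          simp [hr]
        have hmem : word (FreeMonoid.ofList r) * q k ∈ initSpan q n :=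
          Submodule.smul_mem _ (word (FreeMonoid.ofList r)) (mem_initSpan q hk)
        have hl : IsLead (word (FreeMonoid.ofList r) * q k) v := by
          rw [hv]; exact (isLead_word _).mul (hlead k hk)
        by_cases h0 : s - word (FreeMonoid.ofList r) * q k = 0
        · exact ⟨0, by rw [sub_zero, sub_eq_zero.1 h0]; exact hmem, Or.inl rfl⟩
        · obtain ⟨u, hu, hlt⟩ := hs.sub_same hl h0
          obtain ⟨t, ht, h⟩ := ih u hlt _ hu
          refine ⟨t, ?_, h⟩
          have := Submodule.add_mem _ ht hmem
          convert this using 1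
          abel
  by_cases h0 : s = 0
  · exact ⟨0, by simp [h0], Or.inl rfl⟩
  · obtain ⟨v, hv⟩ := exists_isLead h0
    exact main v s hv

/-- `inc` maps the span of initial terms into the span of one more term, up to a left multiple
by `1 - z₀`. -/
theorem inc_mem_of_recurrence {q : ℕ → WordAlg} {n : ℕ}
    (hrec : ∀ k < n, ∃ s, q (k + 1) = inc (q k) + (1 - letter 0) * s) {p : WordAlg}
    (hp : p ∈ initSpan q n) :
    ∃ p' ∈ initSpan q (n + 1), ∃ s, inc p = p' + (1 - letter 0) * s := by
  induction hp using Submodule.span_induction with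
  | mem x hx =>
    obtain ⟨k, hk, rfl⟩ := hx
    obtain ⟨s, hs⟩ := hrec k hk
    exact ⟨q (k + 1), mem_initSpan q (Nat.succ_lt_succ hk), -s, by rw [hs]; simp⟩
  | zero => exact ⟨0, zero_mem _, 0, by simp⟩
  | add x y hx hy ihx ihy =>
    obtain ⟨a, ha, s, hs⟩ := ihx
    obtain ⟨b, hb, t, ht⟩ := ihy
    exact ⟨a + b, add_mem ha hb, s + t, by rw [map_add, hs, ht, mul_add]; abel⟩
  | smul e x hx ih =>
    induction e using wordAlg_induction with
    | h0 => exact ⟨0, zero_mem _, 0, by simp⟩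
    | hw w =>
      by_cases hw : w = 1
      · subst hw
        rwa [word_one, one_smul]
      · refine ⟨inc (word w) * x, Submodule.smul_mem _ (inc (word w))
          (initSpan_mono q n.le_succ hx), 0, ?_⟩
        rw [smul_eq_mul, inc_word_mul hw]
        simp
    | hadd e f he hf =>
      obtain ⟨a, ha, s, hs⟩ := he
      obtain ⟨b, hb, t, ht⟩ := hf
      exact ⟨a + b, add_mem ha hb, s + t, by rw [add_smul, map_add, hs, ht, mul_add]; abel⟩

/-- A Gram–Schmidt process: each term is changed modulo the span of its predecessors until no
earlier leading word is a suffix of the new one. The recurrence survives because the correction can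
be kept inside the factor multiplied by 1 − z₀. -/
theorem exists_suffixFree {q : ℕ → WordAlg} (h0 : q 0 ≠ 0) (h1 : (q 0).coeff 1 = 0)
    (hrec : ∀ k, ∃ s, q (k + 1) = inc (q k) + (1 - letter 0) * s) (n : ℕ) :
    ∃ (r : ℕ → WordAlg) (w : ℕ → FreeMonoid ℕ),
      (∀ k ≤ n, IsLead (r k) (w k)) ∧
      (∀ k ≤ n, q k - r k ∈ initSpan r k) ∧
      (∀ k < n, ∃ s, r (k + 1) = inc (r k) + (1 - letter 0) * s) ∧
      (∀ j k, j < k → k ≤ n → key (w j) < key (w k) ∧ ¬ (w j).toList <:+ (w k).toList) ∧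
      (∀ k ≤ n, w k ≠ 1) := by
  induction n with
  | zero =>
    obtain ⟨v, hv⟩ := exists_isLead h0
    refine ⟨q, fun _ => v, ?_, ?_, ?_, ?_, ?_⟩
    · intro k hk
      obtain rfl : k = 0 := by omega
      exact hv
    · intro k hk; simp
    · intro k hk; omega
    · intro j k hjk hk; omega
    · rintro k - rfl
      exact hv.1 h1
  | succ n ih =>
    obtain ⟨r, w, hlead, hq, hr, hfree, hw1⟩ := ih
    have hp : ∃ p ∈ initSpan r (n + 1), ∃ s,
        q (n + 1) = inc (r n) + p + (1 - letter 0) * s := by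
      obtain ⟨s, hs⟩ := hrec n
      obtain ⟨p, hp, t, ht⟩ := inc_mem_of_recurrence hr (hq n le_rfl)
      refine ⟨p, hp, s + t, ?_⟩
      have : inc (q n) = inc (r n) + inc (q n - r n) := by rw [← map_add]; simp
      rw [hs, this, ht, mul_add]
      abel
    obtain ⟨p, hp, s, hs⟩ := hp
    -- Reducing `s` rather than the whole new term preserves the form `inc (r n) + (1 - letter 0) *
    -- t`.
    obtain ⟨t, ht, hred⟩ := exists_reduced
      (fun k hk => hlead k (Nat.lt_succ_iff.1 hk)) s (n := n + 1)
    have hinc := (hlead n le_rfl).inc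
    have hwn := hw1 n le_rfl
    have hnew : ∃ v, IsLead (inc (r n) + (1 - letter 0) * t) v ∧ key (incWord (w n)) ≤ key v ∧
        ∀ k ≤ n, v ≠ w k → ¬ (w k).toList <:+ v.toList := by
      -- A proper suffix of `incWord (w n)` avoids the changed letter, so it is already a proper
      -- suffix of `w n`.
      have hcase1 : ∀ k ≤ n, incWord (w n) ≠ w k →
          ¬ (w k).toList <:+ (incWord (w n)).toList := by
        intro k hk hne hsuf
        obtain ⟨a, u, hu⟩ := (word_cases (w n)).resolve_left hwn
        rw [hu, incWord_of_mul] at hsuf hne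
        simp only [FreeMonoid.toList_mul, FreeMonoid.toList_of, List.singleton_append,
          List.suffix_cons_iff] at hsuf
        rcases hsuf with h | h
        · exact hne (FreeMonoid.toList.injective (by simpa using h.symm))
        · rcases hk.lt_or_eq with hk | rfl
          · refine (hfree k n hk le_rfl).2 ?_
            rw [hu]
            exact h.trans (List.suffix_cons _ _)
          · have := h.length_le
            rw [hu] at this
            simp at this
      rcases hred with rfl | ⟨v, hv, hsuf⟩
      · exact ⟨incWord (w n), by simpa using hinc, le_rfl, hcase1⟩
      · have hl := isLead_one_sub_letter.mul hv
        -- The first letters are a positive index and 0, so the two leading words cannot cancel.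
        have hneq : key (incWord (w n)) ≠ key (FreeMonoid.of 0 * v) := by
          intro h
          obtain ⟨a, u, hu⟩ := (word_cases (w n)).resolve_left hwn
          have := key_injective h
          rw [hu, incWord_of_mul] at this
          have := (of_mul_inj this).1
          omega
        rcases lt_or_gt_of_ne hneq with h | h
        · refine ⟨_, hinc.add_of_lt hl h, h.le, ?_⟩
          intro k hk hne hs
          simp only [FreeMonoid.toList_mul, FreeMonoid.toList_of, List.singleton_append,
            List.suffix_cons_iff] at hs
          rcases hs with hs | hs
          · exact hne (FreeMonoid.toList.injective (by simpa using hs.symm))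
          · exact hsuf k (Nat.lt_succ_of_le hk) hs
        · refine ⟨_, ?_, le_rfl, hcase1⟩
          rw [add_comm]
          exact hl.add_of_lt hinc h
    obtain ⟨v, hv, hle, hvsuf⟩ := hnew
    have hgt : ∀ k ≤ n, key (w k) < key v := by
      intro k hk
      have h2 : key (w k) ≤ key (w n) := by
        rcases hk.lt_or_eq with h | rfl
        · exact (hfree k n h le_rfl).1.le
        · exact le_rfl
      exact (h2.trans_lt (key_lt_incWord hwn)).trans_le hle
    let r' := Function.update r (n + 1) (inc (r n) + (1 - letter 0) * t)
    let w' := Function.update w (n + 1) v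
    have hr' : ∀ k ≤ n, r' k = r k := fun k hk => Function.update_of_ne (by omega) _ _
    have hw' : ∀ k ≤ n, w' k = w k := fun k hk => Function.update_of_ne (by omega) _ _
    have hrn : r' (n + 1) = inc (r n) + (1 - letter 0) * t := Function.update_self _ _ _
    have hwn' : w' (n + 1) = v := Function.update_self _ _ _
    have hspan : ∀ k ≤ n + 1, initSpan r' k = initSpan r k := by
      intro k hk
      unfold initSpan
      congr 1
      refine Set.image_congr fun j hj => hr' j ?_
      have : j < k := hj
      omega
    refine ⟨r', w', ?_, ?_, ?_, ?_, ?_⟩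
    · intro k hk
      rcases Nat.le_succ_iff.1 hk with hk | rfl
      · rw [hr' k hk, hw' k hk]; exact hlead k hk
      · rw [hrn, hwn']; exact hv
    · intro k hk
      rw [hspan k hk]
      rcases Nat.le_succ_iff.1 hk with hk | rfl
      · rw [hr' k hk]; exact hq k hk
      · rw [hrn, hs]
        have := Submodule.add_mem _ hp (Submodule.smul_mem _ (1 - letter 0) ht)
        convert this using 1
        rw [smul_eq_mul, mul_sub]
        abel
    · intro k hk
      rcases (Nat.lt_succ_iff.1 hk).lt_or_eq with h | rfl
      · rw [hr' k h.le, hr' (k + 1) h]; exact hr k h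
      · rw [hr' k le_rfl, hrn]; exact ⟨t, rfl⟩
    · intro j k hjk hk
      rcases Nat.le_succ_iff.1 hk with hk | rfl
      · rw [hw' k hk, hw' j (by omega)]; exact hfree j k hjk hk
      · have hj : j ≤ n := by omega
        rw [hw' j hj, hwn']
        refine ⟨hgt j hj, hvsuf j hj fun h => ?_⟩
        have := hgt j hj
        rw [h] at this
        exact lt_irrefl _ this
    · intro k hk
      rcases Nat.le_succ_iff.1 hk with hk | rfl
      · rw [hw' k hk]; exact hw1 k hk
      · rw [hwn']
        rintro rfl
        refine absurd (hgt n le_rfl) (not_lt.2 (key_le_of_suffix ?_))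
        exact List.nil_suffix

/-- A sequence that increments its first letters up to left multiples of `1 - z₀` is left
linearly independent as soon as its first term is nonzero. -/
theorem eq_zero_of_mul_mem_initSpan {q : ℕ → WordAlg} (h0 : q 0 ≠ 0) (h1 : (q 0).coeff 1 = 0)
    (hrec : ∀ k, ∃ s, q (k + 1) = inc (q k) + (1 - letter 0) * s) {n : ℕ} {e : WordAlg}
    (he : e * q n ∈ initSpan q n) : e = 0 := by
  obtain ⟨r, w, hlead, hq, -, hfree, -⟩ := exists_suffixFree h0 h1 hrec n
  refine eq_zero_of_suffixFree hlead hfree ?_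
  have hle : initSpan q n ≤ initSpan r n := by
    refine Submodule.span_le.2 ?_
    rintro _ ⟨k, hk, rfl⟩
    have hk : k < n := hk
    have := add_mem (initSpan_mono r hk.le (hq k hk.le)) (mem_initSpan r hk)
    simpa using this
  have h2 := sub_mem (hle he) (Submodule.smul_mem _ e (hq n le_rfl))
  convert h2 using 1
  rw [smul_eq_mul, mul_sub]
  abel

/-! ### Columns and the two operators. -/

/-- The left module of finitely supported columns over the algebra of words. -/
abbrev Col : Type := ℕ →₀ WordAlg

/-- The standard basis of the module of columns. -/
noncomputable abbrev basisCol (k : ℕ) : Col := Finsupp.single k 1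

theorem col_induction {P : Col → Prop} (h : Col) (h0 : P 0)
    (hw : ∀ k w, P (Finsupp.single k (word w))) (hadd : ∀ g h, P g → P h → P (g + h)) : P h := by
  induction h using Finsupp.induction_linear with
  | zero => exact h0
  | add f g hf hg => exact hadd f g hf hg
  | single k p =>
    induction p using wordAlg_induction with
    | h0 => simpa using h0
    | hw w => exact hw k w
    | hadd p q hp hq => rw [Finsupp.single_add]; exact hadd _ _ hp hq

theorem single_eq_smul (k : ℕ) (p : WordAlg) : Finsupp.single k p = p • basisCol k := by
  simp

/-- The constant coefficient. -/
noncomputable def aug : WordAlg →ₐ[ZMod 2] ZMod 2 :=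
  MonoidAlgebra.lift (ZMod 2) (ZMod 2) (FreeMonoid ℕ) (FreeMonoid.lift fun _ => 0)

theorem aug_letter (j : ℕ) : aug (letter j) = 0 := by simp [aug]

theorem aug_of_mul (a : ℕ) (t : FreeMonoid ℕ) : aug (word (FreeMonoid.of a * t)) = 0 := by
  rw [← word_mul_word, map_mul, aug_letter, zero_mul]

theorem aug_word_of_ne_one {w : FreeMonoid ℕ} (h : w ≠ 1) : aug (word w) = 0 := by
  obtain ⟨a, t, rfl⟩ := (word_cases w).resolve_left h
  exact aug_of_mul a t

theorem aug_eq_coeff (p : WordAlg) : aug p = p.coeff 1 := by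
  induction p using wordAlg_induction with
  | h0 => simp
  | hw w =>
    by_cases h : w = 1
    · subst h; rw [word_one, map_one]; simp [MonoidAlgebra.one_def]
    · rw [aug_word_of_ne_one h]; simp [h]
  | hadd p q hp hq => simp [hp, hq]

/-- The right shift of columns. -/
noncomputable def opX : Module.End WordAlg Col :=
  Finsupp.linearCombination WordAlg fun k => basisCol (k + 1)

/-- Images of the basis columns under the twisted left shift. -/
noncomputable def shiftCol : ℕ → Col
  | 0 => 0
  | k + 1 => basisCol k - letter k • basisCol 0

/-- The twisted left shift of columns. -/
noncomputable def opA : Module.End WordAlg Col :=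
  Finsupp.linearCombination WordAlg shiftCol

theorem opX_single (k : ℕ) (p : WordAlg) :
    opX (Finsupp.single k p) = Finsupp.single (k + 1) p := by
  simp [opX]

theorem opA_single (k : ℕ) (p : WordAlg) : opA (Finsupp.single k p) = p • shiftCol k := by
  simp [opA]

theorem opA_zero (p : WordAlg) : opA (Finsupp.single 0 p) = 0 := by
  simp [opA, shiftCol]

theorem opA_succ (k : ℕ) : opA (basisCol (k + 1)) = basisCol k - letter k • basisCol 0 := by
  simp [opA, shiftCol]

theorem opA_relation : opA = opA ^ 2 * opX := by
  refine Finsupp.lhom_ext' fun k => LinearMap.ext_ring ?_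
  simp only [LinearMap.comp_apply, Finsupp.lsingle_apply, pow_two, Module.End.mul_apply,
    opX_single]
  rw [opA_succ, map_sub, map_smul, opA_zero, smul_zero, sub_zero]

/-! ### The ring and its representation. -/

/-- The generator `a`. -/
noncomputable def genA : DKNRing := RingQuot.mkAlgHom (ZMod 2) DKNRel (FreeAlgebra.ι _ Gen.a)

/-- The generator `x`. -/
noncomputable def genX : DKNRing := RingQuot.mkAlgHom (ZMod 2) DKNRel (FreeAlgebra.ι _ Gen.x)

theorem genA_relation : genA = genA ^ 2 * genX := by
  have := RingQuot.mkAlgHom_rel (ZMod 2) DKNRel.rel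
  rwa [map_mul, map_pow] at this

/-- Operators on columns assigned to the generators. -/
noncomputable def genOp : Gen → Module.End WordAlg Col
  | Gen.a => opA
  | Gen.x => opX

/-- The representation of the ring on columns. -/
noncomputable def rep : DKNRing →ₐ[ZMod 2] Module.End WordAlg Col :=
  RingQuot.liftAlgHom (ZMod 2) ⟨FreeAlgebra.lift (ZMod 2) genOp, by
    rintro _ _ ⟨⟩
    simpa [genOp] using opA_relation⟩

theorem rep_genA : rep genA = opA := by
  rw [rep, genA, RingQuot.liftAlgHom_mkAlgHom_apply, FreeAlgebra.lift_ι_apply, genOp]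

theorem rep_genX : rep genX = opX := by
  rw [rep, genX, RingQuot.liftAlgHom_mkAlgHom_apply, FreeAlgebra.lift_ι_apply, genOp]

theorem dkn_induction {P : DKNRing → Prop} (r : DKNRing) (h0 : P 0) (h1 : P 1)
    (hadd : ∀ r s, P r → P s → P (r + s)) (ha : ∀ r, P r → P (genA * r))
    (hx : ∀ r, P r → P (genX * r)) : P r := by
  suffices h : ∀ (t : FreeAlgebra (ZMod 2) Gen) (s : DKNRing), P s →
      P (RingQuot.mkAlgHom (ZMod 2) DKNRel t * s) by
    obtain ⟨t, rfl⟩ := RingQuot.mkAlgHom_surjective (ZMod 2) DKNRel r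
    simpa using h t 1 h1
  intro t
  induction t using FreeAlgebra.induction with
  | grade0 c =>
    intro s hs
    rw [AlgHom.commutes, ← Algebra.smul_def]
    rcases smul_eq_zero_or_self c s with h | h <;> rw [h] <;> assumption
  | grade1 g =>
    intro s hs
    cases g
    · exact ha s hs
    · exact hx s hs
  | mul p q hp hq =>
    intro s hs
    rw [map_mul, mul_assoc]
    exact hp _ (hq s hs)
  | add p q hp hq =>
    intro s hs
    rw [map_add, add_mul]
    exact hadd _ _ (hp s hs) (hq s hs)

/-! ### The shift and the kernel lemma. -/

/-- The shift of columns that increments the last index of each word. -/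
noncomputable def shift : Col →ₗ[ZMod 2] Col :=
  Finsupp.lsum (ZMod 2) fun k =>
    (Finsupp.lsingle k).comp (inc - (Algebra.linearMap (ZMod 2) WordAlg).comp aug.toLinearMap) +
      (Finsupp.lsingle (k + 1)).comp ((Algebra.linearMap (ZMod 2) WordAlg).comp aug.toLinearMap)

theorem shift_single (k : ℕ) (p : WordAlg) : shift (Finsupp.single k p) =
    Finsupp.single k (inc p - algebraMap (ZMod 2) WordAlg (aug p)) +
      Finsupp.single (k + 1) (algebraMap (ZMod 2) WordAlg (aug p)) := by
  simp [shift]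

theorem shift_basisCol (k : ℕ) : shift (basisCol k) = basisCol (k + 1) := by
  have : inc 1 = 1 := by rw [← word_one, inc_word, incWord_one]
  rw [shift_single, this, map_one, map_one]
  simp

theorem shift_single_word {w : FreeMonoid ℕ} (hw : w ≠ 1) (k : ℕ) :
    shift (Finsupp.single k (word w)) = Finsupp.single k (inc (word w)) := by
  rw [shift_single, aug_word_of_ne_one hw]
  simp

theorem mul_ne_one_of_left {v w : FreeMonoid ℕ} (hw : w ≠ 1) : w * v ≠ 1 := by
  obtain ⟨a, t, rfl⟩ := (word_cases w).resolve_left hw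
  rw [mul_assoc]
  exact of_mul_ne_one _ _

theorem shift_word_smul {w : FreeMonoid ℕ} (hw : w ≠ 1) (h : Col) :
    shift (word w • h) = inc (word w) • h := by
  induction h using col_induction with
  | h0 => simp
  | hw k v =>
    rw [Finsupp.smul_single, smul_eq_mul, word_mul_word,
      shift_single_word (mul_ne_one_of_left hw), ← word_mul_word, inc_word_mul hw]
    simp
  | hadd g h hg hh => rw [smul_add, map_add, hg, hh, smul_add]

theorem opX_shift (h : Col) : opX (shift h) = shift (opX h) := by
  induction h using col_induction with
  | h0 => simp
  | hw k w =>
    by_cases hw : w = 1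
    · subst hw
      rw [word_one, shift_basisCol, opX_single, opX_single, shift_basisCol]
    · rw [shift_single_word hw, opX_single, opX_single, shift_single_word hw]
  | hadd g h hg hh => simp only [map_add, hg, hh]

/-- The defect comes only from e₀: the shift sends it to e₁, and a·e₁ = (1 − z₀)e₀ while a·e₀ = 0.
-/
theorem opA_shift (h : Col) :
    opA (shift h) = shift (opA h) + aug (h 0) • (1 - letter 0 : WordAlg) • basisCol 0 := by
  induction h using col_induction with
  | h0 => simp
  | hw k w =>
    by_cases hw : w = 1
    · subst hw
      rw [word_one, shift_basisCol, opA_succ]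
      cases k with
      | zero => rw [opA_zero]; simp [sub_smul]
      | succ k =>
        rw [opA_succ, map_sub, shift_basisCol, shift_word_smul (by exact of_mul_ne_one k 1),
          inc_word]
        simp
        rfl
    · rw [shift_single_word hw, opA_single, opA_single, shift_word_smul hw]
      have : aug ((Finsupp.single k (word w) : Col) 0) = 0 := by
        rw [Finsupp.single_apply]
        split_ifs
        · exact aug_word_of_ne_one hw
        · exact map_zero _
      rw [this, zero_smul, add_zero]
  | hadd g h hg hh =>
    rw [map_add, map_add, hg, hh, map_add, map_add, Finsupp.add_apply, map_add, add_smul]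
    abel

/-- Columns as elements of the augmentation ideal. -/
noncomputable def colToWord : Col →ₗ[WordAlg] WordAlg := Finsupp.linearCombination WordAlg letter

theorem colToWord_single (k : ℕ) (p : WordAlg) :
    colToWord (Finsupp.single k p) = p * letter k := by
  simp [colToWord]

/-- The column w·eₖ is read as the word wzₖ, whose first letter lies in w unless w is empty; this
explains the two summands of `shift`. -/
theorem colToWord_shift (h : Col) : colToWord (shift h) = inc (colToWord h) := by
  induction h using col_induction with
  | h0 => simp
  | hw k w =>
    by_cases hw : w = 1
    · subst hw
      rw [word_one, shift_basisCol, colToWord_single, colToWord_single, one_mul, one_mul, inc_word]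
      rfl
    · rw [shift_single_word hw, colToWord_single, colToWord_single, inc_word_mul hw]
  | hadd g h hg hh => simp only [map_add, hg, hh]

theorem coeff_one_colToWord (h : Col) : (colToWord h).coeff 1 = 0 := by
  rw [← aug_eq_coeff]
  induction h using col_induction with
  | h0 => simp
  | hw k w => rw [colToWord_single, map_mul, aug_letter, mul_zero]
  | hadd g h hg hh => simp only [map_add, hg, hh, add_zero]

theorem coeff_colToWord (h : Col) (k : ℕ) (w : FreeMonoid ℕ) :
    (colToWord h).coeff (w * FreeMonoid.of k) = (h k).coeff w := by
  induction h using col_induction with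
  | h0 => simp
  | hw j v =>
    rw [colToWord_single, word_mul_word]
    by_cases hj : j = k
    · subst hj
      by_cases hv : v = w
      · subst hv; simp
      · have : v * FreeMonoid.of j ≠ w * FreeMonoid.of j := fun h => hv (mul_right_cancel h)
        simp [Ne.symm hv]
    · have : v * FreeMonoid.of j ≠ w * FreeMonoid.of k := by
        intro h
        have h2 := congrArg (fun u => u.toList.getLast?) h
        simp at h2
        exact hj h2
      simp [hj, this]
  | hadd g h hg hh => simp [hg, hh]

theorem colToWord_injective : Function.Injective colToWord := by
  rw [← LinearMap.ker_eq_bot, LinearMap.ker_eq_bot']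
  intro h hh
  ext k w
  rw [← coeff_colToWord, hh]
  simp

/-- Both operators are `W`-linear, so left multiples of 1 − z₀ pass through them and the defects
from `opA_shift` accumulate in `m`. -/
theorem exists_rep_basisCol_succ (g : DKNRing) (k : ℕ) : ∃ m : Col,
    rep g (basisCol (k + 1)) = shift (rep g (basisCol k)) + (1 - letter 0 : WordAlg) • m := by
  induction g using dkn_induction with
  | h0 => exact ⟨0, by simp⟩
  | h1 => exact ⟨0, by rw [map_one, Module.End.one_apply, Module.End.one_apply,
      shift_basisCol]; simp⟩
  | hadd r s hr hs =>
    obtain ⟨m, hm⟩ := hr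
    obtain ⟨n, hn⟩ := hs
    refine ⟨m + n, ?_⟩
    rw [map_add, LinearMap.add_apply, LinearMap.add_apply, hm, hn, map_add, smul_add]
    abel
  | ha r hr =>
    obtain ⟨m, hm⟩ := hr
    refine ⟨opA m + aug (rep r (basisCol k) 0) • basisCol 0, ?_⟩
    rw [map_mul, rep_genA, Module.End.mul_apply, Module.End.mul_apply, hm, map_add, opA_shift,
      map_smul, smul_add, smul_comm]
    abel
  | hx r hr =>
    obtain ⟨m, hm⟩ := hr
    refine ⟨opX m, ?_⟩
    rw [map_mul, rep_genX, Module.End.mul_apply, Module.End.mul_apply, hm, map_add, opX_shift,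
      map_smul]

/-- A ring element annihilating a column annihilates all basis columns of lower index. -/
theorem rep_basisCol_eq_zero {g : DKNRing} {h : Col} (hg : rep g h = 0) {j k : ℕ} (hjk : j ≤ k)
    (hk : h k ≠ 0) : rep g (basisCol j) = 0 := by
  classical
  by_contra hj
  have hex : ∃ j, rep g (basisCol j) ≠ 0 := ⟨j, hj⟩
  let l := Nat.find hex
  have hl : rep g (basisCol l) ≠ 0 := Nat.find_spec hex
  -- Below `l` the columns vanish, so the relation given by `h` only involves the independent
  -- columns from `l` to the top index `n` of `h`.
  have hmin : ∀ i < l, rep g (basisCol i) = 0 := fun i hi => not_not.1 (Nat.find_min hex hi)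
  have hlk : l ≤ k := (Nat.find_min' hex hj).trans hjk
  have hne : h.support.Nonempty := ⟨k, by simpa using hk⟩
  obtain ⟨n, hn, hmax⟩ := Finset.exists_max_image h.support id hne
  have hln : l ≤ n := hlk.trans (hmax k (by simpa using hk))
  obtain ⟨N, rfl⟩ := Nat.exists_eq_add_of_le hln
  let q : ℕ → WordAlg := fun i => colToWord (rep g (basisCol (l + i)))
  have hq0 : q 0 ≠ 0 := fun h0 => hl (colToWord_injective (by simpa [q] using h0))
  refine (Finsupp.mem_support_iff.1 hn) (eq_zero_of_mul_mem_initSpan (q := q) (n := N) hq0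
    (coeff_one_colToWord _) ?_ ?_)
  · intro i
    obtain ⟨m, hm⟩ := exists_rep_basisCol_succ g (l + i)
    refine ⟨colToWord m, ?_⟩
    simp only [q]
    rw [← add_assoc, hm, map_add, colToWord_shift, map_smul, smul_eq_mul]
  · have hsum : ∑ i ∈ h.support, h i * colToWord (rep g (basisCol i)) = 0 := by
      have h1 : h = ∑ i ∈ h.support, h i • basisCol i := by
        conv_lhs => rw [← Finsupp.sum_single h]
        simp [Finsupp.sum]
      rw [h1] at hg
      have h2 := congrArg colToWord hg
      simpa only [map_sum, map_smul, smul_eq_mul, map_zero] using h2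
    rw [← Finset.add_sum_erase _ _ hn] at hsum
    rw [eq_neg_of_add_eq_zero_left hsum]
    refine neg_mem (sum_mem fun i hi => ?_)
    obtain ⟨hi1, hi2⟩ := Finset.mem_erase.1 hi
    have hi3 : i ≤ l + N := hmax i hi2
    rcases lt_or_ge i l with hil | hil
    · rw [hmin i hil]; simp
    · obtain ⟨t, rfl⟩ := Nat.exists_eq_add_of_le hil
      exact Submodule.smul_mem _ (h (l + t)) (mem_initSpan q (show t < N by omega))

/-! ### Normal forms and faithfulness. -/

/-- The element `1 - a x`. -/
noncomputable def genF : DKNRing := 1 - genA * genX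

theorem genA_mul_genF : genA * genF = 0 := by
  rw [genF, mul_sub, mul_one, ← mul_assoc, ← pow_two, ← genA_relation, sub_self]

/-- The anti-homomorphism from the algebra of words sending the letter `zⱼ` to `(1 - a x) xʲ`. -/
noncomputable def wordToRing : WordAlg →ₐ[ZMod 2] DKNRingᵐᵒᵖ :=
  MonoidAlgebra.lift (ZMod 2) DKNRingᵐᵒᵖ (FreeMonoid ℕ)
    (FreeMonoid.lift fun j => MulOpposite.op (genF * genX ^ j))

theorem wordToRing_letter (j : ℕ) :
    wordToRing (letter j) = MulOpposite.op (genF * genX ^ j) := by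
  simp [wordToRing]

/-- The linear map sending a column to the ring element that maps the first basis column to it. -/
noncomputable def colToRing : Col →ₗ[ZMod 2] DKNRing :=
  Finsupp.lsum (ZMod 2) fun k => (LinearMap.mulLeft (ZMod 2) (genX ^ k)).comp
    ((MulOpposite.opLinearEquiv (ZMod 2)).symm.toLinearMap.comp wordToRing.toLinearMap)

theorem colToRing_single (k : ℕ) (p : WordAlg) :
    colToRing (Finsupp.single k p) = genX ^ k * (wordToRing p).unop := by
  simp [colToRing]

theorem colToRing_basisCol_zero : colToRing (basisCol 0) = 1 := by
  rw [colToRing_single]; simp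

theorem genX_mul_colToRing (h : Col) : genX * colToRing h = colToRing (opX h) := by
  induction h using col_induction with
  | h0 => simp
  | hw k w => rw [opX_single, colToRing_single, colToRing_single, pow_succ', mul_assoc]
  | hadd g h hg hh => rw [map_add, mul_add, hg, hh, map_add, map_add]

theorem word_cases_last (w : FreeMonoid ℕ) : w = 1 ∨ ∃ t a, w = t * FreeMonoid.of a := by
  rcases List.eq_nil_or_concat w.toList with h | ⟨t, a, h⟩
  · exact Or.inl h
  · exact Or.inr ⟨FreeMonoid.ofList t, a, FreeMonoid.toList.injective (by simpa using h)⟩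

/-- The rewriting rule behind the normal form. A nonempty word at index 0 gives a ring element
starting with `genF`, which a kills; only the empty word there leaves a new factor a. -/
theorem genA_mul_colToRing (h : Col) :
    genA * colToRing h = colToRing (opA h) + aug (h 0) • genA := by
  induction h using col_induction with
  | h0 => simp
  | hw k w =>
    rw [colToRing_single, opA_single]
    cases k with
    | zero =>
      rcases word_cases_last w with rfl | ⟨t, j, rfl⟩
      · simp [shiftCol, word_one]
      · have h1 : aug ((Finsupp.single 0 (word (t * FreeMonoid.of j)) : Col) 0) = 0 := by
          rw [Finsupp.single_eq_same, ← word_mul_word, map_mul, aug_letter, mul_zero]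
        rw [h1, ← word_mul_word, map_mul, wordToRing_letter]
        simp only [MulOpposite.unop_mul, MulOpposite.unop_op, shiftCol, smul_zero, map_zero,
          zero_smul, add_zero, pow_zero, one_mul]
        rw [← mul_assoc, ← mul_assoc, genA_mul_genF, zero_mul, zero_mul]
    | succ k =>
      have h1 : genA * genX ^ (k + 1) = genX ^ k - genF * genX ^ k := by
        rw [pow_succ', ← mul_assoc, genF, sub_mul, one_mul, sub_sub_cancel]
      rw [← mul_assoc, h1, shiftCol, smul_sub, smul_smul, ← single_eq_smul, ← single_eq_smul,
        map_sub, colToRing_single, colToRing_single, map_mul, wordToRing_letter]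
      simp only [MulOpposite.unop_mul, MulOpposite.unop_op, pow_zero, one_mul]
      simp [sub_mul]
  | hadd g h hg hh =>
    rw [map_add, mul_add, hg, hh, map_add, map_add, Finsupp.add_apply, map_add, add_smul]
    abel

theorem rep_genF_basisCol (j : ℕ) : rep genF (basisCol j) = letter j • basisCol 0 := by
  rw [genF, map_sub, map_one, map_mul, rep_genA, rep_genX, LinearMap.sub_apply,
    Module.End.one_apply, Module.End.mul_apply, opX_single, opA_succ, sub_sub_cancel]

theorem opX_pow_single (j k : ℕ) (p : WordAlg) :
    (opX ^ j) (Finsupp.single k p) = Finsupp.single (k + j) p := by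
  induction j with
  | zero => simp
  | succ j ih => rw [pow_succ', Module.End.mul_apply, ih, opX_single, add_assoc]

theorem rep_wordToRing_basisCol_zero (w : FreeMonoid ℕ) :
    rep (wordToRing (word w)).unop (basisCol 0) = word w • basisCol 0 := by
  induction w using FreeMonoid.inductionOn' with
  | one => rw [word_one, map_one, MulOpposite.unop_one, map_one, one_smul, Module.End.one_apply]
  | of_mul j w ih =>
    rw [← word_mul_word, map_mul, wordToRing_letter, MulOpposite.unop_mul, MulOpposite.unop_op,
      map_mul, map_mul, map_pow, rep_genX, Module.End.mul_apply, Module.End.mul_apply,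
      opX_pow_single, zero_add, rep_genF_basisCol, map_smul, ih, smul_smul]

theorem rep_colToRing_basisCol_zero (h : Col) : rep (colToRing h) (basisCol 0) = h := by
  induction h using col_induction with
  | h0 => simp
  | hw k w =>
    rw [colToRing_single, map_mul, map_pow, rep_genX, Module.End.mul_apply,
      rep_wordToRing_basisCol_zero, map_smul, opX_pow_single, zero_add, ← single_eq_smul]
  | hadd g h hg hh => rw [map_add, map_add, LinearMap.add_apply, hg, hh]

theorem opA_pow_eq_zero {i j : ℕ} (h : i < j) : (opA ^ j) (basisCol i) = 0 := by
  induction j generalizing i with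
  | zero => omega
  | succ j ih =>
    rw [pow_succ, Module.End.mul_apply]
    cases i with
    | zero => rw [opA_zero, map_zero]
    | succ i =>
      rw [opA_succ, map_sub, map_smul, ih (show i < j by omega), ih (show 0 < j by omega)]
      simp

theorem opA_pow_succ (i : ℕ) :
    (opA ^ (i + 1)) (basisCol (i + 1)) = (1 - letter 0 : WordAlg) • basisCol 0 := by
  induction i with
  | zero => rw [zero_add, pow_one, opA_succ, sub_smul, one_smul]
  | succ i ih =>
    rw [pow_succ, Module.End.mul_apply, opA_succ, map_sub, map_smul, ih,
      opA_pow_eq_zero (show 0 < i + 1 by omega), smul_zero, sub_zero]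

theorem one_sub_letter_ne_zero : (1 - letter 0 : WordAlg) ≠ 0 := isLead_one_sub_letter.ne_zero

theorem exists_opA_pow_self (i : ℕ) :
    ∃ p : WordAlg, p ≠ 0 ∧ (opA ^ i) (basisCol i) = p • basisCol 0 := by
  cases i with
  | zero => exact ⟨1, one_ne_zero, by simp⟩
  | succ i => exact ⟨_, one_sub_letter_ne_zero, opA_pow_succ i⟩

theorem opA_pow_self_ne_zero (i : ℕ) : (opA ^ i) (basisCol i) ≠ 0 := by
  obtain ⟨p, hp, h⟩ := exists_opA_pow_self i
  rw [h, ← single_eq_smul]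
  simpa using hp

/-- Every ring element is a sum of terms `θ(hᵢ) aⁱ`. -/
theorem exists_normalForm (r : DKNRing) :
    ∃ s : ℕ →₀ Col, r = s.sum fun i h => colToRing h * genA ^ i := by
  have hadd : ∀ s t : ℕ →₀ Col, ((s + t).sum fun i h => colToRing h * genA ^ i) =
      (s.sum fun i h => colToRing h * genA ^ i) + t.sum fun i h => colToRing h * genA ^ i :=
    fun s t => Finsupp.sum_add_index' (by simp) (by simp [add_mul])
  have hgen : ∀ (g : DKNRing), (∀ i h, ∃ s : ℕ →₀ Col, g * (colToRing h * genA ^ i) =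
      s.sum fun i h => colToRing h * genA ^ i) → ∀ s : ℕ →₀ Col, ∃ t : ℕ →₀ Col,
      g * (s.sum fun i h => colToRing h * genA ^ i) =
        t.sum fun i h => colToRing h * genA ^ i := by
    intro g hg s
    induction s using Finsupp.induction_linear with
    | zero => exact ⟨0, by simp⟩
    | add s t hs ht =>
      obtain ⟨s', hs⟩ := hs
      obtain ⟨t', ht⟩ := ht
      exact ⟨s' + t', by rw [hadd, mul_add, hs, ht, hadd]⟩
    | single i h =>
      obtain ⟨s, hs⟩ := hg i h
      exact ⟨s, by rw [Finsupp.sum_single_index (by simp), hs]⟩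
  induction r using dkn_induction with
  | h0 => exact ⟨0, by simp⟩
  | h1 =>
    refine ⟨Finsupp.single 0 (basisCol 0), ?_⟩
    rw [Finsupp.sum_single_index (by simp), colToRing_basisCol_zero, pow_zero, mul_one]
  | hadd r s hr hs =>
    obtain ⟨r', rfl⟩ := hr
    obtain ⟨s', rfl⟩ := hs
    exact ⟨r' + s', (hadd _ _).symm⟩
  | ha r hr =>
    obtain ⟨s, rfl⟩ := hr
    refine hgen genA (fun i h => ?_) s
    refine ⟨Finsupp.single i (opA h) +
      Finsupp.single (i + 1) (aug (h 0) • basisCol 0), ?_⟩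
    rw [hadd, Finsupp.sum_single_index (by simp), Finsupp.sum_single_index (by simp),
      ← mul_assoc, genA_mul_colToRing, map_smul, colToRing_basisCol_zero, add_mul, pow_succ']
    simp
  | hx r hr =>
    obtain ⟨s, rfl⟩ := hr
    refine hgen genX (fun i h => ?_) s
    refine ⟨Finsupp.single i (opX h), ?_⟩
    rw [Finsupp.sum_single_index (by simp), ← mul_assoc, genX_mul_colToRing]

/-- The representation on columns is faithful. -/
theorem rep_injective : Function.Injective rep := by
  rw [injective_iff_map_eq_zero]
  intro r hr
  obtain ⟨s, rfl⟩ := exists_normalForm r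
  by_contra hne
  have hs : s.support.Nonempty := by
    rw [Finset.nonempty_iff_ne_empty]
    intro h
    exact hne (by rw [Finsupp.sum, h, Finset.sum_empty])
  -- Evaluating at eᵢ for the least exponent i kills all higher powers of a, leaving a nonzero
  -- multiple of the i-th coefficient column.
  obtain ⟨i, hi, hmin⟩ := Finset.exists_min_image s.support id hs
  have h1 := congrArg (fun φ : Module.End WordAlg Col => φ (basisCol i)) hr
  simp only [Finsupp.sum, map_sum, map_mul, map_pow, rep_genA, LinearMap.sum_apply,
    Module.End.mul_apply, LinearMap.zero_apply] at h1
  rw [Finset.sum_eq_single i] at h1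
  · obtain ⟨p, hp, h2⟩ := exists_opA_pow_self i
    rw [h2, map_smul, rep_colToRing_basisCol_zero] at h1
    refine Finsupp.mem_support_iff.1 hi (Finsupp.ext fun k => ?_)
    have h3 := DFunLike.congr_fun h1 k
    exact (mul_eq_zero.1 h3).resolve_left hp
  · intro j hj hji
    have : i < j := lt_of_le_of_ne (hmin j hj) (Ne.symm hji)
    rw [opA_pow_eq_zero this, map_zero]
  · exact fun h => absurd hi h

/-! ### Units are upper unitriangular. -/

/-- The columns supported below `n`. -/
noncomputable abbrev lowCol (n : ℕ) : Submodule WordAlg Col :=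
  Finsupp.supported WordAlg WordAlg (Set.Iio n)

theorem mem_lowCol {n : ℕ} {h : Col} : h ∈ lowCol n ↔ ∀ k, n ≤ k → h k = 0 := by
  rw [Finsupp.mem_supported']
  simp

theorem basisCol_mem {j n : ℕ} (h : j < n) : basisCol j ∈ lowCol n :=
  Finsupp.single_mem_supported _ _ h

theorem lowCol_mono {m n : ℕ} (h : m ≤ n) : lowCol m ≤ lowCol n :=
  Finsupp.supported_mono (Set.Iio_subset_Iio h)

theorem map_mem_of_basisCol {φ : Module.End WordAlg Col} {n : ℕ} {W : Submodule WordAlg Col}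
    (hφ : ∀ j < n, φ (basisCol j) ∈ W) {h : Col} (hh : h ∈ lowCol n) : φ h ∈ W := by
  have hle : lowCol n ≤ W.comap φ := by
    rw [lowCol, Finsupp.supported_eq_span_single]
    refine Submodule.span_le.2 ?_
    rintro _ ⟨j, hj, rfl⟩
    exact hφ j hj
  exact hle hh

theorem exists_ne_zero_of_notMem {n : ℕ} {h : Col} (hh : h ∉ lowCol n) :
    ∃ k, n ≤ k ∧ h k ≠ 0 := by
  rw [mem_lowCol] at hh
  push Not at hh
  exact hh

theorem rep_apply_rep {u v : DKNRing} (h : u * v = 1) (c : Col) : rep u (rep v c) = c := by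
  rw [← Module.End.mul_apply, ← map_mul, h, map_one, Module.End.one_apply]

theorem rep_unit_mem_lowCol (n : ℕ) : ∀ {u v : DKNRing}, u * v = 1 → v * u = 1 →
    ∀ {h : Col}, h ∈ lowCol n → rep v h ∈ lowCol n := by
  induction n with
  | zero =>
    intro u v _ _ h hh
    have : h = 0 := Finsupp.ext fun k => mem_lowCol.1 hh k (Nat.zero_le _)
    rw [this, map_zero]
    exact zero_mem _
  | succ n ih =>
    intro u v huv hvu h hh
    refine map_mem_of_basisCol (fun j hj => ?_) hh
    rcases (Nat.lt_succ_iff.1 hj).lt_or_eq with hj | rfl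
    · exact lowCol_mono n.le_succ (ih huv hvu (basisCol_mem hj))
    -- As u·eⱼ has a nonzero entry at an index at least j and is killed by aʲ⁺¹v, the kernel lemma
    -- gives aʲ⁺¹v·eⱼ = 0. A nonzero entry of v·eⱼ beyond j would then force aʲ⁺¹eⱼ₊₁ = 0.
    · have hnot : rep u (basisCol j) ∉ lowCol j := by
        intro hmem
        have h1 := ih huv hvu hmem
        rw [rep_apply_rep hvu, mem_lowCol] at h1
        simpa using h1 j le_rfl
      obtain ⟨k, hk, hne⟩ := exists_ne_zero_of_notMem hnot
      have hz : rep (genA ^ (j + 1) * v) (rep u (basisCol j)) = 0 := by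
        rw [map_mul, Module.End.mul_apply, rep_apply_rep hvu, map_pow, rep_genA,
          opA_pow_eq_zero j.lt_succ_self]
      have h2 := rep_basisCol_eq_zero hz hk hne
      by_contra hnot2
      obtain ⟨l, hl, hne2⟩ := exists_ne_zero_of_notMem hnot2
      rw [map_mul, Module.End.mul_apply] at h2
      have h3 := rep_basisCol_eq_zero h2 hl hne2
      rw [map_pow, rep_genA] at h3
      exact opA_pow_self_ne_zero (j + 1) h3

/-- The algebra of words over `𝔽₂` has no nontrivial units. -/
theorem eq_one_of_mul_eq_one {p q : WordAlg} (h : p * q = 1) : p = 1 := by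
  have hp : p ≠ 0 := by rintro rfl; simp at h
  have hq : q ≠ 0 := by rintro rfl; simp at h
  obtain ⟨u, hu⟩ := exists_isLead hp
  obtain ⟨v, hv⟩ := exists_isLead hq
  have huv := hu.mul hv
  rw [h] at huv
  have h1 : u * v = 1 := by
    by_contra hne
    exact huv.1 (by simp [MonoidAlgebra.one_def, hne])
  have hu1 : u = 1 := by
    have := congrArg FreeMonoid.length h1
    simp only [FreeMonoid.length_mul, FreeMonoid.length_one, Nat.add_eq_zero_iff] at this
    exact FreeMonoid.length_eq_zero.1 this.1
  subst hu1
  ext w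
  by_cases hw : w = 1
  · subst hw
    rw [hu.coeff_eq_one]; simp [MonoidAlgebra.one_def]
  · have : p.coeff w = 0 := by
      by_contra hne
      exact hw (key_injective (le_antisymm (hu.2 w hne) (key_le_of_suffix List.nil_suffix)))
    rw [this]
    simp [MonoidAlgebra.one_def, hw]

/-- By triangularity the diagonal entries of u and v multiply to 1, and 1 is the only unit of `W`.
-/
theorem rep_unit_diag {u v : DKNRing} (huv : u * v = 1) (hvu : v * u = 1) (n : ℕ) :
    rep u (basisCol n) - basisCol n ∈ lowCol n := by
  have hu : ∀ h ∈ lowCol (n + 1), rep u h ∈ lowCol (n + 1) :=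
    fun h hh => rep_unit_mem_lowCol _ hvu huv hh
  have hlow : rep u (basisCol n) - rep u (basisCol n) n • basisCol n ∈ lowCol n := by
    rw [mem_lowCol]
    intro k hk
    rcases hk.lt_or_eq with hk | rfl
    · have := mem_lowCol.1 (hu _ (basisCol_mem n.lt_succ_self)) k hk
      simp [this, hk.ne]
    · simp
  have hone : rep u (basisCol n) n = 1 := by
    refine eq_one_of_mul_eq_one (q := rep v (basisCol n) n) ?_
    have h1 := rep_unit_mem_lowCol _ huv hvu hlow
    rw [map_sub, rep_apply_rep hvu, map_smul] at h1
    have h2 := mem_lowCol.1 h1 n le_rfl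
    rw [Finsupp.sub_apply, Finsupp.smul_apply, smul_eq_mul, Finsupp.single_eq_same,
      sub_eq_zero] at h2
    exact h2.symm
  rwa [hone, one_smul] at hlow

/-! ### Eventual shift invariance and the symbol. -/

theorem shift_apply (h : Col) (k : ℕ) : shift h k =
    inc (h k) - algebraMap (ZMod 2) WordAlg (aug (h k)) +
      (if k = 0 then 0 else algebraMap (ZMod 2) WordAlg (aug (h (k - 1)))) := by
  induction h using Finsupp.induction_linear with
  | zero => simp
  | add f g hf hg =>
    rw [map_add, Finsupp.add_apply, hf, hg]
    simp only [Finsupp.add_apply, map_add]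
    split_ifs <;> abel
  | single j p =>
    rw [shift_single, Finsupp.add_apply]
    cases k with
    | zero => by_cases hj : j = 0 <;> simp [hj]
    | succ k =>
      by_cases hj : j = k + 1
      · subst hj; simp
      · by_cases hj2 : j = k
        · subst hj2; simp
        · have : j + 1 ≠ k + 1 := by omega
          simp [hj, hj2]

theorem aug_inc (p : WordAlg) : aug (inc p) = aug p := by
  induction p using wordAlg_induction with
  | h0 => simp
  | hw w =>
    rcases word_cases w with rfl | ⟨a, t, rfl⟩
    · rw [inc_word, incWord_one]
    · rw [inc_word, incWord_of_mul, aug_of_mul, aug_of_mul]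
  | hadd p q hp hq => simp only [map_add, hp, hq]

theorem aug_shift_zero (h : Col) : aug (shift h 0) = 0 := by
  rw [shift_apply, map_add, map_sub, aug_inc, AlgHom.commutes]
  simp

theorem aug_shift_succ (h : Col) (k : ℕ) : aug (shift h (k + 1)) = aug (h k) := by
  rw [shift_apply, if_neg k.succ_ne_zero, map_add, map_sub, aug_inc, AlgHom.commutes,
    AlgHom.commutes, Nat.add_sub_cancel]
  simp

/-- Each ring element commutes with the shift on basis columns of large index. -/
theorem exists_rep_eq_shift (g : DKNRing) :
    ∃ m, ∀ k, m ≤ k → rep g (basisCol (k + 1)) = shift (rep g (basisCol k)) := by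
  induction g using dkn_induction with
  | h0 => exact ⟨0, fun k _ => by simp⟩
  | h1 => exact ⟨0, fun k _ => by
      rw [map_one, Module.End.one_apply, Module.End.one_apply, shift_basisCol]⟩
  | hadd r s hr hs =>
    obtain ⟨m, hm⟩ := hr
    obtain ⟨n, hn⟩ := hs
    refine ⟨max m n, fun k hk => ?_⟩
    rw [map_add, LinearMap.add_apply, LinearMap.add_apply, map_add,
      hm k ((le_max_left _ _).trans hk), hn k ((le_max_right _ _).trans hk)]
  | ha r hr =>
    obtain ⟨m, hm⟩ := hr
    -- One more index makes the column at `k` itself a shift, so its entry at 0 has no constant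
    -- coefficient and the defect in `opA_shift` vanishes.
    refine ⟨m + 1, fun k hk => ?_⟩
    obtain ⟨i, rfl⟩ : ∃ i, k = i + 1 := ⟨k - 1, by omega⟩
    rw [map_mul, rep_genA, Module.End.mul_apply, Module.End.mul_apply, hm (i + 1) (by omega),
      opA_shift, hm i (by omega), aug_shift_zero, zero_smul, add_zero]
  | hx r hr =>
    obtain ⟨m, hm⟩ := hr
    refine ⟨m, fun k hk => ?_⟩
    rw [map_mul, rep_genX, Module.End.mul_apply, Module.End.mul_apply, hm k hk, opX_shift]

open Polynomial in
/-- The polynomial formed by the constant coefficients of a column. -/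
noncomputable def symbol : Col →ₗ[ZMod 2] (ZMod 2)[X] :=
  Finsupp.lsum (ZMod 2) fun k => (Polynomial.monomial k).comp aug.toLinearMap

theorem symbol_single (k : ℕ) (p : WordAlg) :
    symbol (Finsupp.single k p) = Polynomial.monomial k (aug p) := by
  simp [symbol]

theorem coeff_symbol (h : Col) (k : ℕ) : (symbol h).coeff k = aug (h k) := by
  induction h using Finsupp.induction_linear with
  | zero => simp
  | add f g hf hg => rw [map_add, Polynomial.coeff_add, hf, hg, Finsupp.add_apply, map_add]
  | single j p =>
    rw [symbol_single, Polynomial.coeff_monomial, Finsupp.single_apply]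
    split_ifs <;> simp

theorem symbol_smul (p : WordAlg) (h : Col) : symbol (p • h) = aug p • symbol h := by
  ext k
  rw [coeff_symbol, Finsupp.smul_apply, smul_eq_mul, map_mul, Polynomial.coeff_smul, coeff_symbol,
    smul_eq_mul]

theorem symbol_shift (h : Col) : symbol (shift h) = Polynomial.X * symbol h := by
  ext k
  rw [coeff_symbol]
  cases k with
  | zero => rw [aug_shift_zero, Polynomial.coeff_X_mul_zero]
  | succ k => rw [aug_shift_succ, Polynomial.coeff_X_mul, coeff_symbol]

theorem symbol_rep_basisCol {g : DKNRing} {m : ℕ}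
    (hm : ∀ k, m ≤ k → rep g (basisCol (k + 1)) = shift (rep g (basisCol k))) (i : ℕ) :
    symbol (rep g (basisCol (m + i))) = Polynomial.X ^ i * symbol (rep g (basisCol m)) := by
  induction i with
  | zero => simp
  | succ i ih => rw [← add_assoc, hm _ (by omega), symbol_shift, ih, pow_succ', mul_assoc]

/-- On constant coefficients g acts, from index m on, as multiplication by a fixed polynomial up to
a power of X. -/
theorem symbol_rep {g : DKNRing} {m : ℕ}
    (hm : ∀ k, m ≤ k → rep g (basisCol (k + 1)) = shift (rep g (basisCol k))) {h : Col}
    (hh : ∀ j < m, aug (h j) = 0) : Polynomial.X ^ m * symbol (rep g h) =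
      symbol h * symbol (rep g (basisCol m)) := by
  have h1 : h = ∑ i ∈ h.support, h i • basisCol i := by
    conv_lhs => rw [← Finsupp.sum_single h]
    simp [Finsupp.sum]
  have h2 : symbol (rep g h) = ∑ i ∈ h.support, aug (h i) • symbol (rep g (basisCol i)) := by
    conv_lhs => rw [h1]
    simp only [map_sum, map_smul, symbol_smul]
  have h3 : symbol h = ∑ i ∈ h.support, aug (h i) • Polynomial.X ^ i := by
    conv_lhs => rw [h1]
    simp only [map_sum, symbol_smul, symbol_single, map_one, Polynomial.monomial_one_right_eq_X_pow]
  rw [h2, h3, Finset.mul_sum, Finset.sum_mul]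
  refine Finset.sum_congr rfl fun i _ => ?_
  rcases lt_or_ge i m with hi | hi
  · simp [hh i hi]
  · obtain ⟨j, rfl⟩ := Nat.exists_eq_add_of_le hi
    rw [symbol_rep_basisCol hm, mul_smul_comm, smul_mul_assoc, ← mul_assoc, pow_add]

theorem eq_X_pow_of_dvd {P : Polynomial (ZMod 2)} {m n : ℕ} (hP : P ∣ Polynomial.X ^ n)
    (hm : P.coeff m = 1) : P = Polynomial.X ^ m := by
  obtain ⟨i, -, c, hc⟩ := (dvd_prime_pow Polynomial.prime_X n).1 hP
  obtain ⟨r, hr, hrc⟩ := Polynomial.isUnit_iff.1 c.isUnit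
  rw [← hrc, zmod_two_eq_one hr.ne_zero, map_one, mul_one] at hc
  subst hc
  rw [Polynomial.coeff_X_pow] at hm
  split_ifs at hm with h
  · rw [h]
  · exact absurd hm (by decide)

theorem symbol_rep_unit {u v : DKNRing} (huv : u * v = 1) (hvu : v * u = 1) {m : ℕ}
    (hu : ∀ k, m ≤ k → rep u (basisCol (k + 1)) = shift (rep u (basisCol k)))
    (hv : ∀ k, m ≤ k → rep v (basisCol (k + 1)) = shift (rep v (basisCol k))) :
    symbol (rep u (basisCol m)) = Polynomial.X ^ m := by
  -- The symbol of v·e₂ₘ is divisible by Xᵐ, so `symbol_rep` applies to u; since uv·e₂ₘ = e₂ₘ, the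
  -- symbol of u·eₘ divides X³ᵐ.
  refine eq_X_pow_of_dvd (n := m + (m + m)) ?_ ?_
  · have h1 := symbol_rep hu (h := rep v (basisCol (m + m))) fun j hj => by
      rw [← coeff_symbol, symbol_rep_basisCol hv, Polynomial.coeff_X_pow_mul', if_neg (by omega)]
    rw [rep_apply_rep huv, symbol_single, map_one, Polynomial.monomial_one_right_eq_X_pow,
      ← pow_add] at h1
    exact ⟨_, by rw [h1, mul_comm]⟩
  · have h1 := mem_lowCol.1 (rep_unit_diag huv hvu m) m le_rfl
    rw [Finsupp.sub_apply, sub_eq_zero, Finsupp.single_eq_same] at h1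
    rw [coeff_symbol, h1, map_one]

/-- Only constant coefficients are moved to the next index, and a vanishing symbol means there are
none. -/
theorem shift_mem_lowCol {h : Col} {m : ℕ} (hh : h ∈ lowCol m) (hs : symbol h = 0) :
    shift h ∈ lowCol m := by
  rw [mem_lowCol] at hh ⊢
  intro k hk
  have haug : ∀ j, aug (h j) = 0 := fun j => by rw [← coeff_symbol, hs, Polynomial.coeff_zero]
  rw [shift_apply, haug, haug, hh k hk]
  simp

/-! ### Strict elements. -/

/-- Elements acting as strictly upper triangular matrices with finitely many nonzero rows. -/
def IsStrict (r : DKNRing) : Prop :=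
  (∀ n, ∀ h ∈ lowCol (n + 1), rep r h ∈ lowCol n) ∧ ∃ m, ∀ h, rep r h ∈ lowCol m

theorem IsStrict.add {r s : DKNRing} (hr : IsStrict r) (hs : IsStrict s) : IsStrict (r + s) := by
  obtain ⟨h1, m, hm⟩ := hr
  obtain ⟨h2, n, hn⟩ := hs
  refine ⟨fun k h hh => ?_, max m n, fun h => ?_⟩
  · rw [map_add]
    exact add_mem (h1 k h hh) (h2 k h hh)
  · rw [map_add]
    exact add_mem (lowCol_mono (le_max_left _ _) (hm h)) (lowCol_mono (le_max_right _ _) (hn h))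

theorem IsStrict.isNilpotent {r : DKNRing} (hr : IsStrict r) : IsNilpotent r := by
  obtain ⟨h1, m, hm⟩ := hr
  have hpow : ∀ i h, h ∈ lowCol i → rep (r ^ i) h = 0 := by
    intro i
    induction i with
    | zero =>
      intro h hh
      have : h = 0 := Finsupp.ext fun k => mem_lowCol.1 hh k (Nat.zero_le _)
      rw [this, map_zero]
    | succ i ih =>
      intro h hh
      rw [pow_succ, map_mul, Module.End.mul_apply]
      exact ih _ (h1 i h hh)
  -- One application lands in `lowCol m`; each of the m others lowers the bound by one.
  refine ⟨m + 1, rep_injective (LinearMap.ext fun h => ?_)⟩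
  rw [pow_succ, map_mul, Module.End.mul_apply, hpow m _ (hm h), map_zero, LinearMap.zero_apply]

/-- Units differ from `1` by strictly upper triangular elements. -/
theorem isStrict_sub_one {u : DKNRing} (hu : IsUnit u) : IsStrict (u - 1) := by
  obtain ⟨⟨u, v, huv, hvu⟩, rfl⟩ := hu
  change IsStrict (u - 1)
  have happ : ∀ h, rep (u - 1) h = rep u h - h := fun h => by
    rw [map_sub, map_one, LinearMap.sub_apply, Module.End.one_apply]
  have hdiag : ∀ j, rep (u - 1) (basisCol j) ∈ lowCol j := fun j => by
    rw [happ]; exact rep_unit_diag huv hvu j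
  refine ⟨fun n h hh => map_mem_of_basisCol (fun j hj => ?_) hh, ?_⟩
  · exact lowCol_mono (Nat.lt_succ_iff.1 hj) (hdiag j)
  obtain ⟨m₁, hm₁⟩ := exists_rep_eq_shift u
  obtain ⟨m₂, hm₂⟩ := exists_rep_eq_shift v
  let m := max m₁ m₂
  have hu : ∀ k, m ≤ k → rep u (basisCol (k + 1)) = shift (rep u (basisCol k)) :=
    fun k hk => hm₁ k ((le_max_left _ _).trans hk)
  have hv : ∀ k, m ≤ k → rep v (basisCol (k + 1)) = shift (rep v (basisCol k)) :=
    fun k hk => hm₂ k ((le_max_right _ _).trans hk)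
  -- The columns of u − 1 from `m` on are successive shifts of one column with zero symbol, so they
  -- never leave `lowCol m`.
  have hlarge : ∀ i, rep (u - 1) (basisCol (m + i)) ∈ lowCol m ∧
      symbol (rep (u - 1) (basisCol (m + i))) = 0 := by
    intro i
    induction i with
    | zero =>
      refine ⟨hdiag m, ?_⟩
      rw [add_zero, happ, map_sub, symbol_rep_unit huv hvu hu hv, symbol_single, map_one,
        Polynomial.monomial_one_right_eq_X_pow, sub_self]
    | succ i ih =>
      have hs : rep (u - 1) (basisCol (m + (i + 1))) =
          shift (rep (u - 1) (basisCol (m + i))) := by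
        rw [happ, happ, ← add_assoc, hu _ (by omega), map_sub, shift_basisCol]
      rw [hs]
      exact ⟨shift_mem_lowCol ih.1 ih.2, by rw [symbol_shift, ih.2, mul_zero]⟩
  refine ⟨m, fun h => ?_⟩
  obtain ⟨n, hn⟩ : ∃ n, h ∈ lowCol n := by
    obtain ⟨n, hn⟩ := h.support.bddAbove
    refine ⟨n + 1, mem_lowCol.2 fun k hk => ?_⟩
    by_contra hne
    have : k ≤ n := hn (by simpa using hne)
    omega
  refine map_mem_of_basisCol (fun j _ => ?_) hn
  rcases lt_or_ge j m with hj | hj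
  · exact lowCol_mono hj.le (hdiag j)
  · obtain ⟨i, rfl⟩ := Nat.exists_eq_add_of_le hj
    exact (hlarge i).1

/-! ### The Jacobson radical and the four conclusions. -/

theorem isUnit_one_add_mul_of_mem_jacobson {S : Type*} [Ring S] {j : S}
    (hj : j ∈ Ring.jacobson S) (y : S) : IsUnit (1 + y * j) := by
  rw [← Ideal.jacobson_bot, Ideal.mem_jacobson_iff] at hj
  obtain ⟨z, hz⟩ := hj y
  -- The left inverse z equals 1 − zyj, again of the form 1 plus a multiple of j, so it has a left
  -- inverse too and is two-sided.
  obtain ⟨t, ht⟩ := hj (-(z * y))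
  rw [Ideal.mem_bot, sub_eq_zero] at hz ht
  have h1 : z * (1 + y * j) = 1 := by rw [mul_add, mul_one, ← mul_assoc, add_comm, hz]
  have h2 : t * z = 1 := by
    have h3 : z = 1 - z * y * j := eq_sub_of_add_eq' hz
    calc t * z = t * (1 - z * y * j) := by rw [← h3]
      _ = t * -(z * y) * j + t := by noncomm_ring
      _ = 1 := ht
  have h3 : t = 1 + y * j := left_inv_eq_right_inv h2 h1
  exact ⟨⟨1 + y * j, z, by rw [← h3, h2], h1⟩, rfl⟩

/-- The column xᵏj·eₖ must be supported below k, yet xᵏ moves every entry of j·eₖ to an index at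
least k. -/
theorem jacobson_eq_bot : Ring.jacobson DKNRing = ⊥ := by
  rw [eq_bot_iff]
  intro j hj
  rw [Ideal.mem_bot]
  refine rep_injective (Finsupp.lhom_ext' fun k => LinearMap.ext_ring (Finsupp.ext fun l => ?_))
  have h1 := isStrict_sub_one (isUnit_one_add_mul_of_mem_jacobson hj (genX ^ k))
  rw [add_sub_cancel_left] at h1
  have h2 := mem_lowCol.1 (h1.1 k (basisCol k) (basisCol_mem k.lt_succ_self)) (l + k)
    (Nat.le_add_left _ _)
  have h3 : ∀ h : Col, (opX ^ k) h (l + k) = h l := by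
    intro h
    induction h using Finsupp.induction_linear with
    | zero => simp
    | add f g hf hg => rw [map_add (opX ^ k), Finsupp.add_apply, hf, hg, Finsupp.add_apply]
    | single i p => rw [opX_pow_single]; simp [Finsupp.single_apply]
  rw [map_mul, map_pow, rep_genX, Module.End.mul_apply, h3] at h2
  simpa using h2

theorem not_isRightDischinger : ¬ IsRightDischinger DKNRing := by
  intro h
  obtain ⟨-, n, -, y, hy⟩ := h genA ⟨1, le_rfl, genX, by simpa using genA_relation⟩
  have h1 := congrArg (fun r => rep r (basisCol n)) hy
  simp only [map_mul, map_pow, rep_genA, Module.End.mul_apply] at h1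
  rw [opA_pow_eq_zero n.lt_succ_self, map_zero] at h1
  exact opA_pow_self_ne_zero n h1

theorem isUURing : IsUURing DKNRing := fun _ hu => (isStrict_sub_one hu).isNilpotent

/-- Since 1 + n is a unit, n is strict, and so is n + (u − 1); adding 1 to this nilpotent gives a
unit. -/
theorem isUnit_add {n u : DKNRing} (hn : IsNilpotent n) (hu : IsUnit u) : IsUnit (n + u) := by
  have h1 : IsStrict n := by
    have := isStrict_sub_one hn.isUnit_one_add
    rwa [add_sub_cancel_left] at this
  have h2 := (h1.add (isStrict_sub_one hu)).isNilpotent.isUnit_one_add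
  convert h2 using 1
  abel

end DKN

theorem theorem3p10 :
    IsUURing DKNRing ∧
    ¬ IsRightDischinger DKNRing ∧
    Ring.jacobson DKNRing = ⊥ ∧
    {r : DKNRing | IsNilpotent r} + {u : DKNRing | IsUnit u} ⊆ {u : DKNRing | IsUnit u} := by
  refine ⟨DKN.isUURing, DKN.not_isRightDischinger, DKN.jacobson_eq_bot, ?_⟩
  rintro _ ⟨n, hn, u, hu, rfl⟩
  exact DKN.isUnit_add hn hu
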